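/- Let $V$ be a finite-dimensional vector space over a finite field $\mathbb{F}_q$ of order $q$ and characteristic $p$, let $Z$ be the group of all nonzero scalar transformations of $V$, and let $G$ be a $p$-solvable group with $Z\le G\le GL(V)$. (A finite group is $p$-solvable if it has a normal series each of whose factors is a $p$-group or a group of order prime to $p$.) A set $B\subseteq V$ is a base for $G$ if only the identity of $G$ fixes every vector of $B$; it is a strong base for $G$ if every element of $G$ that maps the subspace $\langle v\rangle$ to itself for every $v\in B$ is a scalar transformation. Let $b(G)$ and $b^*(G)$ be the minimal sizes of a base and of a strong base for $G$, respectively. Put $t(q)=3$ for $q\le 4$ and $t(q)=2$ for $q\ge 5$. If $b(G)\le t(q)$, then $b^*(G)\le t(q)$. -/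

import Mathlib

namespace LinearBase

/-- A finite group `H` is `p`-solvable if it has a series `1 = N 0 ≤ N 1 ≤ ⋯ ≤ N n = H` of normal
subgroups of `H`, each factor `N (i + 1) / N i` of which is a `p`-group or a `p'`-group. The order
of the factor is `(N i).relIndex (N (i + 1))`. -/
def IsPSolvable (p : ℕ) (H : Type*) [Group H] : Prop :=
  ∃ (n : ℕ) (N : ℕ → Subgroup H), N 0 = ⊥ ∧ N n = ⊤ ∧ (∀ i ≤ n, (N i).Normal) ∧
    ∀ i < n, N i ≤ N (i + 1) ∧
      ((∃ k : ℕ, (N i).relIndex (N (i + 1)) = p ^ k) ∨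
        p.Coprime ((N i).relIndex (N (i + 1))))

variable {F V : Type*} [Field F] [AddCommGroup V] [Module F V]

variable (F V) in
/-- The group `Z` of scalar transformations `v ↦ c • v`, `c ∈ Fˣ`, as a subgroup of `GL(V)`. -/
def scalars : Subgroup (LinearMap.GeneralLinearGroup F V) :=
  (Units.map (algebraMap F (Module.End F V) : F →* Module.End F V)).range

/-- `B ⊆ V` is a base for `G ≤ GL(V)` if its pointwise stabilizer in `G` is trivial. -/
def IsBase (G : Subgroup (LinearMap.GeneralLinearGroup F V)) (B : Finset V) : Prop :=
  ∀ g ∈ G, (∀ v ∈ B, (g : Module.End F V) v = v) → g = 1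

/-- `B ⊆ V` is a strong base for `G ≤ GL(V)` if every element of `G` that maps each of the
subspaces `⟨v⟩`, `v ∈ B`, onto itself is a scalar transformation. -/
def IsStrongBase (G : Subgroup (LinearMap.GeneralLinearGroup F V)) (B : Finset V) : Prop :=
  ∀ g ∈ G, (∀ v ∈ B, (Submodule.span F {v}).map (g : Module.End F V) = Submodule.span F {v}) →
    g ∈ scalars F V

/-- The minimal base size `b(G)`; when `V` is finite, the set `V` itself is a base. -/
noncomputable def baseSize (G : Subgroup (LinearMap.GeneralLinearGroup F V)) : ℕ :=
  sInf {k | ∃ B : Finset V, B.card = k ∧ IsBase G B}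

/-- The minimal strong base size `b*(G)`; when `V` is finite, the set `V` itself is a strong
base. -/
noncomputable def strongBaseSize (G : Subgroup (LinearMap.GeneralLinearGroup F V)) : ℕ :=
  sInf {k | ∃ B : Finset V, B.card = k ∧ IsStrongBase G B}

/-- `t(q) = 3` for `q ≤ 4` and `t(q) = 2` for `q ≥ 5`. -/
def t (q : ℕ) : ℕ := if q ≤ 4 then 3 else 2

end LinearBase

/-!
Let `B` be a base for `G` of size at most `t q` and let `U` be its span. An element of `G` that
stabilizes `U` is determined by its action on `U`, so the group `H` of restrictions to `U` of
elements of `G` is again `p`-solvable (`IsBase.isPSolvable_restrictionGroup`), and a set of vectors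
spanning `U` whose members are common eigenvectors only of the scalars in `H` is a strong base for
`G` (`IsBase.isStrongBase_of_isScalarTest`). It remains to find such a set of at most `t q` vectors,
called a scalar test for `H`, when `dim U ≤ t q`.

Suppose that no basis of `U` is a scalar test: every basis admits a nonscalar element of `H` that is
diagonal in it. Then `dim U` is two or three, and `H` contains all transvections. To see this, fix a
basis `(x, w₁, w₂)` and consider the elements of `H` that fix `x` and act diagonally on `U / ⟨x⟩`
with respect to the images of `w₁, w₂`. They act as diagonal affine maps on the plane of complements
`⟨w₁ + α x, w₂ + β x⟩` of `⟨x⟩`, and by assumption each point `(α, β)` of this plane is fixed by a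
member with nontrivial diagonal part. Commutators of two such maps are translations, that is,
transvections with centre `x`; as the translation group is stable under the diagonal parts, it
turns out to contain one of the two coordinate axes (`translations_of_fixes`). Varying `w₁` and `w₂`
yields all transvections with centre `x`. In dimension two the same argument runs with a line of
complements `⟨w + α x⟩`.

On the other hand, each transvection is a commutator of a transvection with a `p'`-element that is
a product of transvections (`transvection_eq_commutator`), provided that `q ≥ 4` in dimension two
and `q ≥ 3` in dimension three. Hence neither a `p`-factor nor a `p'`-factor of a normal series can
separate the transvections from `1`, and `H` is not `p`-solvable
(`IsPSolvable.exists_transvection_notMem`). The case that escapes this argument, `q ≤ 4` in dimension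
two, is settled by the three vectors `b₀`, `b₁`, `b₀ + b₁`; for `q = 2` every diagonal element is
trivial.
-/

namespace LinearBase

open Module
open LinearEquiv (transvection transvections transvection_mem_transvections)

variable {F V : Type*} [Field F] [AddCommGroup V] [Module F V]

/-! ### `p`-solvable groups -/

theorem mem_of_pow_mem_of_coprime {A : Type*} [Group A] (N : Subgroup A) [N.Normal] {x : A}
    {m n : ℕ} (hm : x ^ m ∈ N) (hn : x ^ n ∈ N) (h : m.Coprime n) : x ∈ N := by
  rw [← QuotientGroup.eq_one_iff] at *
  rw [QuotientGroup.mk_pow] at hm hn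
  simpa [h.gcd_eq_one] using pow_gcd_eq_one.2 ⟨hm, hn⟩

theorem IsPSolvable.of_injective {p : ℕ} (hp : p.Prime) {A B : Type*} [Group A] [Group B]
    (φ : A →* B) (hφ : Function.Injective φ) (h : IsPSolvable p B) : IsPSolvable p A := by
  obtain ⟨n, N, h0, hn, hN, hstep⟩ := h
  refine ⟨n, fun i => (N i).comap φ, ?_, ?_, fun i hi => ?_, fun i hi => ⟨?_, ?_⟩⟩
  · simp only [h0]
    exact (MonoidHom.ker_eq_bot_iff φ).2 hφ
  · simp [hn]
  · have := hN i hi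
    infer_instance
  · exact Subgroup.comap_mono (hstep i hi).1
  · have := hN i hi.le
    have hdvd : ((N i).comap φ).relIndex ((N (i + 1)).comap φ) ∣ (N i).relIndex (N (i + 1)) := by
      have hle := Subgroup.map_comap_le φ (N (i + 1))
      rw [Subgroup.relIndex_comap, ← Subgroup.relIndex_subgroupOf hle]
      exact Subgroup.relIndex_dvd_index_of_normal _ _
    rcases (hstep i hi).2 with ⟨k, hk⟩ | hc
    · rw [hk] at hdvd
      obtain ⟨j, -, hj⟩ := (Nat.dvd_prime_pow hp).1 hdvd
      exact Or.inl ⟨j, hj⟩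
    · exact Or.inr (hc.coprime_dvd_right hdvd)

/-- A set of elements of order dividing `p`, each a commutator `d s' d⁻¹ s'⁻¹` of a member `s'` of
the set with a `p'`-element `d` of the subgroup it generates, is trivial in a `p`-solvable group:
descending the series, a `p'`-factor kills the elements `s`, and a `p`-factor kills the
elements `d`. -/
theorem IsPSolvable.eq_one_of_eq_commutator {p : ℕ} {A : Type*} [Group A] (h : IsPSolvable p A)
    (S : Set A) (hS : ∀ s ∈ S, s ^ p = 1)
    (hc : ∀ s ∈ S, ∃ d ∈ Subgroup.closure S, ∃ m : ℕ, p.Coprime m ∧ d ^ m = 1 ∧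
      ∃ s' ∈ S, s = d * s' * d⁻¹ * s'⁻¹) :
    ∀ s ∈ S, s = 1 := by
  obtain ⟨n, N, h0, hn, hN, hstep⟩ := h
  have key : ∀ i ≤ n, S ⊆ N i → S ⊆ N 0 := by
    intro i
    induction i with
    | zero => exact fun _ h => h
    | succ i ih =>
      intro hi hSi
      have hnorm := hN i (by lia)
      refine ih (by lia) fun s hs => ?_
      rcases (hstep i hi).2 with ⟨k, hk⟩ | hcop
      · obtain ⟨d, hd, m, hpm, hdm, s', hs', rfl⟩ := hc s hs
        have hdN : d ∈ N (i + 1) := (Subgroup.closure_le _).2 hSi hd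
        have hd' : d ∈ N i := by
          refine mem_of_pow_mem_of_coprime (N i) (m := p ^ k) (n := m) ?_ ?_ (hpm.pow_left k)
          · rw [← hk]
            exact (N i).pow_relIndex_mem hdN
          · rw [hdm]
            exact one_mem _
        have := mul_mem hd' (hnorm.conj_mem _ (inv_mem hd') s')
        simpa [mul_assoc] using this
      · refine mem_of_pow_mem_of_coprime (N i) ?_ ((N i).pow_relIndex_mem (hSi hs)) hcop
        rw [hS s hs]
        exact one_mem _
  intro s hs
  have := key n le_rfl (by simp [hn]) hs
  simpa [h0] using this

/-! ### Diagonal affine maps of a plane over a finite field -/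

theorem mem_of_apply_mem {α : Type*} [Finite α] {f : α → α} (hf : Function.Injective f)
    {S : Set α} (hS : ∀ z ∈ S, f z ∈ S) {z : α} (hz : f z ∈ S) : z ∈ S := by
  have : f '' S = S :=
    Set.eq_of_subset_of_ncard_le (by rintro _ ⟨y, hy, rfl⟩; exact hS y hy)
      (by rw [Set.ncard_image_of_injective S hf]) S.toFinite
  rw [← this] at hz
  exact (hf.mem_set_image).1 hz

/-- Let a group of diagonal affine maps of `F × F` be given, where `P l m r s` says that the map
with diagonal part `(l, m)` and translation part `(r, s)` belongs to it. If every point `(α, β)` is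
fixed by a member with nontrivial diagonal part, then the group contains all translations in
one of the two coordinate directions. -/
theorem translations_of_fixes [Finite F] (P : Fˣ → Fˣ → F → F → Prop)
    (hmul : ∀ {l m r s l' m' r' s'}, P l m r s → P l' m' r' s' →
      P (l * l') (m * m') (l' * r + r') (m' * s + s'))
    (hinv : ∀ {l m r s}, P l m r s → P l⁻¹ m⁻¹ (-(r * (l⁻¹ : Fˣ))) (-(s * (m⁻¹ : Fˣ))))
    (hfix : ∀ α β : F, ∃ l m : Fˣ, (l ≠ 1 ∨ m ≠ 1) ∧ P l m ((l - 1) * α) ((m - 1) * β)) :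
    (∀ a, P 1 1 a 0) ∨ ∀ b, P 1 1 0 b := by
  have hconj : ∀ {l m : Fˣ} {r s a b : F}, P l m r s → P 1 1 a b → P 1 1 (l * a) (m * b) := by
    intro l m r s a b h hN
    convert hmul (hinv h) (hmul hN h) using 1
    · simp
    · simp
    · rw [one_mul, Units.val_inv_eq_inv_val]
      field_simp
      ring
    · rw [one_mul, Units.val_inv_eq_inv_val]
      field_simp
      ring
  have hadd : ∀ {a b a' b' : F}, P 1 1 a b → P 1 1 a' b' → P 1 1 (a + a') (b + b') := by
    intro a b a' b' h h'
    convert hmul h h' using 1 <;> simp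
  have hneg : ∀ {a b : F}, P 1 1 a b → P 1 1 (-a) (-b) := by
    intro a b h
    convert hinv h using 1 <;> simp
  have hsub : ∀ {a b a' b' : F}, P 1 1 a b → P 1 1 a' b' → P 1 1 (a - a') (b - b') := by
    intro a b a' b' h h'
    simpa [sub_eq_add_neg] using hadd h (hneg h')
  have hne : ∀ {l : Fˣ}, l ≠ 1 → (l : F) - 1 ≠ 0 := fun h =>
    sub_ne_zero.2 fun h' => h (Units.ext h')
  -- The translation group is stable under the diagonal parts, hence under dividing by
  -- `(l, m) - (1, 1)` where this makes sense, since `F` is finite.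
  have hdiv : ∀ {l m : Fˣ} {r s a b : F}, P l m r s → l ≠ 1 → m ≠ 1 →
      P 1 1 ((l - 1) * a) ((m - 1) * b) → P 1 1 a b := by
    intro l m r s a b h hl hm hN
    refine mem_of_apply_mem (f := fun z : F × F => ((l - 1) * z.1, (m - 1) * z.2))
      (S := {z | P 1 1 z.1 z.2}) ?_ ?_ (z := (a, b)) hN
    · intro z z' hz
      simpa [Prod.ext_iff, hne hl, hne hm] using hz
    · intro z hz
      simpa [sub_mul] using hsub (hconj h hz) hz
  have hdiv₁ : ∀ {l m : Fˣ} {r s a : F}, P l m r s → l ≠ 1 → P 1 1 ((l - 1) * a) 0 →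
      P 1 1 a 0 := by
    intro l m r s a h hl hN
    refine mem_of_apply_mem (f := fun z : F => (l - 1) * z) (S := {z | P 1 1 z 0}) ?_ ?_ hN
    · exact mul_right_injective₀ (hne hl)
    · intro z hz
      simpa [sub_mul] using hsub (hconj h hz) hz
  have hdiv₂ : ∀ {l m : Fˣ} {r s b : F}, P l m r s → m ≠ 1 → P 1 1 0 ((m - 1) * b) →
      P 1 1 0 b := by
    intro l m r s b h hm hN
    refine mem_of_apply_mem (f := fun z : F => (m - 1) * z) (S := {z | P 1 1 0 z}) ?_ ?_ hN
    · exact mul_right_injective₀ (hne hm)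
    · intro z hz
      simpa [sub_mul] using hsub (hconj h hz) hz
  -- The commutator of two members fixing given points is a translation.
  have hcomm : ∀ {l m l' m' : Fˣ} {α β α' β' : F}, P l m ((l - 1) * α) ((m - 1) * β) →
      P l' m' ((l' - 1) * α') ((m' - 1) * β') →
      P 1 1 ((l - 1) * ((l' - 1) * (α - α'))) ((m - 1) * ((m' - 1) * (β - β'))) := by
    intro l m l' m' α β α' β' h h'
    have := hmul (hinv (hmul h' h)) (hmul h h')
    convert this using 1
    · rw [mul_comm l' l, inv_mul_cancel]
    · rw [mul_comm m' m, inv_mul_cancel]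
    · push_cast
      field_simp
      ring
    · push_cast
      field_simp
      ring
  have h₁₂ : ∀ {l m l' m' : Fˣ} {α β α' β' : F}, P l m ((l - 1) * α) ((m - 1) * β) →
      P l' m' ((l' - 1) * α') ((m' - 1) * β') → l ≠ 1 → m ≠ 1 → l' ≠ 1 → m' ≠ 1 →
      P 1 1 (α - α') (β - β') := fun h h' hl hm hl' hm' =>
    hdiv h' hl' hm' (hdiv h hl hm (hcomm h h'))
  have h₁ : ∀ {l m l' m' : Fˣ} {α β α' β' : F}, P l m ((l - 1) * α) ((m - 1) * β) →
      P l' m' ((l' - 1) * α') ((m' - 1) * β') → l ≠ 1 → l' ≠ 1 → m = 1 →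
      P 1 1 (α - α') 0 := fun h h' hl hl' hm =>
    hdiv₁ h' hl' (hdiv₁ h hl (by simpa [hm] using hcomm h h'))
  have h₂ : ∀ {l m l' m' : Fˣ} {α β α' β' : F}, P l m ((l - 1) * α) ((m - 1) * β) →
      P l' m' ((l' - 1) * α') ((m' - 1) * β') → m ≠ 1 → m' ≠ 1 → l = 1 →
      P 1 1 0 (β - β') := fun h h' hm hm' hl =>
    hdiv₂ h' hm' (hdiv₂ h hm (by simpa [hl] using hcomm h h'))
  by_contra! hcon
  obtain ⟨⟨a, ha⟩, b, hb⟩ := hcon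
  by_cases hX : ∃ (α β : F) (l m : Fˣ), P l m ((l - 1) * α) ((m - 1) * β) ∧ l ≠ 1 ∧ m ≠ 1
  · obtain ⟨α₀, β₀, l₀, m₀, h₀, hl₀, hm₀⟩ := hX
    have hcover : ∀ b, ¬ P 1 1 0 b → P 1 1 a b := by
      intro b hb
      obtain ⟨l, m, hlm, h⟩ := hfix (α₀ + a) (β₀ + b)
      by_cases hl : l = 1
      · exact absurd (by simpa using h₂ h h₀ (by tauto) hm₀ hl) hb
      · by_cases hm : m = 1
        · exact absurd (by simpa using h₁ h h₀ hl hl₀ hm) ha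
        · simpa using h₁₂ h h₀ hl hm hl₀ hm₀
    -- Both `b` and `m₀ b` are missing from the translations in the second direction, so their
    -- difference `(m₀ - 1) b` is not missing.
    have hb' : ¬ P 1 1 0 (m₀ * b) := fun h =>
      hb (mem_of_apply_mem (f := fun z : F => m₀ * z) (S := {z | P 1 1 0 z})
        (mul_right_injective₀ m₀.ne_zero) (fun z hz => by simpa using hconj h₀ hz) h)
    refine hb (hdiv₂ h₀ hm₀ ?_)
    simpa [sub_mul] using hsub (hcover _ hb') (hcover _ hb)
  · push Not at hX
    have hX₁ : ∃ (α β : F) (l m : Fˣ), P l m ((l - 1) * α) ((m - 1) * β) ∧ l ≠ 1 ∧ m = 1 := by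
      by_contra! hno
      have hall : ∀ α β : F, ∃ l m : Fˣ, P l m ((l - 1) * α) ((m - 1) * β) ∧ l = 1 ∧ m ≠ 1 := by
        intro α β
        obtain ⟨l, m, hlm, h⟩ := hfix α β
        by_cases hl : l = 1
        · exact ⟨l, m, h, hl, by tauto⟩
        · exact absurd (hX α β l m h hl) (hno α β l m h hl)
      obtain ⟨l, m, h, hl, hm⟩ := hall 0 b
      obtain ⟨l', m', h', hl', hm'⟩ := hall 0 0
      exact hb (by simpa using h₂ h h' hm hm' hl)
    have hX₂ : ∃ (α β : F) (l m : Fˣ), P l m ((l - 1) * α) ((m - 1) * β) ∧ l = 1 ∧ m ≠ 1 := by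
      by_contra! hno
      have hall : ∀ α β : F, ∃ l m : Fˣ, P l m ((l - 1) * α) ((m - 1) * β) ∧ l ≠ 1 ∧ m = 1 := by
        intro α β
        obtain ⟨l, m, hlm, h⟩ := hfix α β
        by_cases hl : l = 1
        · exact absurd (hno α β l m h hl) (by tauto)
        · exact ⟨l, m, h, hl, hX α β l m h hl⟩
      obtain ⟨l, m, h, hl, hm⟩ := hall a 0
      obtain ⟨l', m', h', hl', hm'⟩ := hall 0 0
      exact ha (by simpa using h₁ h h' hl hl' hm)
    obtain ⟨α₁, β₁, l₁, m₁, hP₁, hl₁, hm₁⟩ := hX₁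
    obtain ⟨α₂, β₂, l₂, m₂, hP₂, hl₂, hm₂⟩ := hX₂
    obtain ⟨l, m, hlm, h⟩ := hfix (α₁ + a) (β₂ + b)
    by_cases hl : l = 1
    · exact hb (by simpa using h₂ h hP₂ (by tauto) hm₂ hl)
    · exact ha (by simpa using h₁ h hP₁ hl hl₁ (hX _ _ l m h hl))

/-! ### Transvections as commutators -/

/-- The diagonal map `diag (a, a⁻¹)` of a plane, extended by the identity to a complement, is a
product of four transvections. -/
theorem exists_mem_closure_transvections_diagonal {x y : V} {e e' : Dual F V} (hx : e x = 1)
    (hy : e y = 0) (hx' : e' x = 0) (hy' : e' y = 1) (a : Fˣ) :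
    ∃ d ∈ Subgroup.closure (transvections F V),
      ∀ v, d v = v + ((a : F) - 1) • e v • x + ((a⁻¹ : Fˣ) - 1 : F) • e' v • y := by
  have h₁ : ∀ r : F, e' (r • x) = 0 := by simp [hx']
  have h₂ : ∀ r : F, e (r • y) = 0 := by simp [hy]
  refine ⟨transvection (h₁ (a - 1)) * transvection (h₂ 1) * transvection (h₁ ((a⁻¹ : Fˣ) - 1)) *
    transvection (h₂ (-a)), ?_, fun v => ?_⟩
  · have hmem : ∀ {f : Dual F V} {w : V} (h : f w = 0),
        transvection h ∈ Subgroup.closure (transvections F V) := fun h =>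
      Subgroup.subset_closure transvection_mem_transvections
    exact mul_mem (mul_mem (mul_mem (hmem _) (hmem _)) (hmem _)) (hmem _)
  · have ha : (a : F) * (a : F)⁻¹ = 1 := mul_inv_cancel₀ a.ne_zero
    simp only [LinearEquiv.mul_apply, LinearEquiv.transvection.apply, map_add, map_smul, hx, hy,
      hx', hy', Units.val_inv_eq_inv_val]
    match_scalars
    · ring
    · linear_combination (e' v - e v * (a : F)) * ha
    · linear_combination (-e v) * ha

theorem pow_apply_diagonal {x y : V} {e e' : Dual F V} (hx : e x = 1)
    (hy : e y = 0) (hx' : e' x = 0) (hy' : e' y = 1) {a b : F} {d : V ≃ₗ[F] V}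
    (hd : ∀ v, d v = v + (a - 1) • e v • x + (b - 1) • e' v • y) (k : ℕ) (v : V) :
    (d ^ k) v = v + (a ^ k - 1) • e v • x + (b ^ k - 1) • e' v • y := by
  induction k with
  | zero => simp
  | succ k ih =>
    rw [pow_succ', LinearEquiv.mul_apply, ih, hd]
    simp only [map_add, map_smul, hx, hy, hx', hy', smul_eq_mul]
    match_scalars <;> ring

theorem exists_commutator_eq_transvection {f : Dual F V} {x : V} (h : f x = 0) {d : V ≃ₗ[F] V}
    {a c : F} (hd : d x = a • x) (hf : ∀ v, f (d v) = c * f v) (hac : a ≠ c) :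
    ∃ s' ∈ transvections F V, transvection h = d * s' * d⁻¹ * s'⁻¹ := by
  have h' : f ((c / (a - c)) • x) = 0 := by simp [h]
  refine ⟨transvection h', transvection_mem_transvections, ?_⟩
  rw [eq_mul_inv_iff_mul_eq, eq_mul_inv_iff_mul_eq]
  ext v
  have hac' : a - c ≠ 0 := sub_ne_zero.2 hac
  simp only [LinearEquiv.mul_apply, LinearEquiv.transvection.apply, map_add, map_smul, hd, h, hf]
  match_scalars
  · rfl
  · field_simp
    ring

theorem exists_dual_pair {x y : V} (h : LinearIndependent F ![x, y]) :
    ∃ e e' : Dual F V, e x = 1 ∧ e y = 0 ∧ e' x = 0 ∧ e' y = 1 := by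
  have key : ∀ x y : V, LinearIndependent F ![x, y] → ∃ e : Dual F V, e x = 1 ∧ e y = 0 := by
    intro x y h
    rw [LinearIndependent.pair_iff] at h
    have hx : x ∉ Submodule.span F {y} := by
      rw [Submodule.mem_span_singleton]
      rintro ⟨r, rfl⟩
      simpa using (h (-1) r (by simp)).1
    obtain ⟨e, he, he'⟩ := Submodule.exists_dual_map_eq_bot_of_notMem hx inferInstance
    have hy : e y = 0 := by
      have : e y ∈ (Submodule.span F {y}).map e :=
        Submodule.mem_map_of_mem (Submodule.mem_span_singleton_self y)
      simpa [he'] using this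
    exact ⟨(e x)⁻¹ • e, by simp [he], by simp [hy]⟩
  obtain ⟨e, h₁, h₂⟩ := key x y h
  obtain ⟨e', h₃, h₄⟩ := key y x (LinearIndependent.pair_symm_iff.1 h)
  exact ⟨e, e', h₁, h₂, h₄, h₃⟩

theorem linearIndependent_pair_of_notMem_span {x y : V} (hx : x ≠ 0)
    (hy : y ∉ Submodule.span F {x}) : LinearIndependent F ![x, y] := by
  rw [LinearIndependent.pair_iff' hx]
  rintro a rfl
  exact hy (Submodule.smul_mem _ _ (Submodule.mem_span_singleton_self x))

theorem exists_linearIndependent_pair_mem_ker [FiniteDimensional F V] (hV : 3 ≤ finrank F V)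
    (f : Dual F V) {x : V} (hx : x ≠ 0) :
    ∃ y, f y = 0 ∧ LinearIndependent F ![x, y] := by
  by_contra! hcon
  have hle : LinearMap.ker f ≤ Submodule.span F {x} := fun y hy => by
    by_contra hxy
    exact hcon y hy (linearIndependent_pair_of_notMem_span hx hxy)
  have h₁ := Submodule.finrank_mono hle
  have h₂ := finrank_span_singleton (K := F) hx
  have h₃ := LinearMap.finrank_range_add_finrank_ker f
  have h₄ := Submodule.finrank_le (LinearMap.range f)
  rw [finrank_self] at h₄
  lia

/-- Over a large enough finite field each transvection is the commutator of a transvection and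
a semisimple product of transvections. -/
theorem transvection_eq_commutator [Finite F] [FiniteDimensional F V]
    (hV : (3 ≤ finrank F V ∧ ∃ a : Fˣ, a ≠ 1) ∨ ∃ a : Fˣ, a * a ≠ 1)
    {s : V ≃ₗ[F] V} (hs : s ∈ transvections F V) :
    ∃ d ∈ Subgroup.closure (transvections F V), d ^ (Nat.card F - 1) = 1 ∧
      ∃ s' ∈ transvections F V, s = d * s' * d⁻¹ * s'⁻¹ := by
  have hpow : ∀ a : Fˣ, (a : F) ^ (Nat.card F - 1) = 1 := by
    intro a
    rw [← Nat.card_units, ← Units.val_pow_eq_pow_val, pow_card_eq_one', Units.val_one]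
  have hdiag : ∀ {x y : V} {e e' : Dual F V} (_ : e x = 1) (_ : e y = 0) (_ : e' x = 0)
      (_ : e' y = 1) (a : Fˣ), ∃ d ∈ Subgroup.closure (transvections F V),
      d ^ (Nat.card F - 1) = 1 ∧
      ∀ v, d v = v + ((a : F) - 1) • e v • x + ((a⁻¹ : Fˣ) - 1 : F) • e' v • y := by
    intro x y e e' h₁ h₂ h₃ h₄ a
    obtain ⟨d, hd, hdv⟩ := exists_mem_closure_transvections_diagonal h₁ h₂ h₃ h₄ a
    refine ⟨d, hd, ?_, hdv⟩
    ext v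
    rw [pow_apply_diagonal h₁ h₂ h₃ h₄ hdv, hpow, hpow]
    simp
  obtain ⟨f, x, h, rfl⟩ := hs
  by_cases hx : x = 0
  · subst hx
    refine ⟨1, one_mem _, one_pow _, transvection h, transvection_mem_transvections, ?_⟩
    ext v
    simp
  rcases hV with ⟨hV, a, ha⟩ | ⟨a, ha⟩
  · obtain ⟨y, hy, hxy⟩ := exists_linearIndependent_pair_mem_ker hV f hx
    obtain ⟨e, e', h₁, h₂, h₃, h₄⟩ := exists_dual_pair hxy
    obtain ⟨d, hd, hd1, hdv⟩ := hdiag h₁ h₂ h₃ h₄ a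
    refine ⟨d, hd, hd1, exists_commutator_eq_transvection h (a := a) (c := 1) ?_ ?_ ?_⟩
    · rw [hdv, h₁, h₃]
      module
    · intro v
      simp [hdv, h, hy]
    · exact fun h => ha (Units.ext h)
  · by_cases hf : f = 0
    · subst hf
      refine ⟨1, one_mem _, one_pow _, transvection h, transvection_mem_transvections, ?_⟩
      ext v
      simp
    obtain ⟨y, hy⟩ : ∃ y, f y = 1 := LinearMap.surjective hf 1
    have hxy : LinearIndependent F ![x, y] := by
      refine linearIndependent_pair_of_notMem_span hx fun hmem => ?_
      obtain ⟨r, rfl⟩ := Submodule.mem_span_singleton.1 hmem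
      simp [h] at hy
    obtain ⟨e, -, h₁, h₂, -, -⟩ := exists_dual_pair hxy
    obtain ⟨d, hd, hd1, hdv⟩ := hdiag h₁ h₂ h hy a
    refine ⟨d, hd, hd1, exists_commutator_eq_transvection h (a := a) (c := (a⁻¹ : Fˣ)) ?_ ?_ ?_⟩
    · rw [hdv, h₁, h]
      module
    · intro v
      simp only [hdv, map_add, map_smul, h, hy, smul_eq_mul]
      ring
    · intro h
      exact ha (by rw [← eq_inv_iff_mul_eq_one]; exact Units.ext h)

/-- A `p`-solvable linear group in characteristic `p` does not contain all transvections. In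
dimension two the condition on `F` excludes exactly the solvable groups `SL₂(2)` and `SL₂(3)`. -/
theorem IsPSolvable.exists_transvection_notMem {p : ℕ} [Finite F] [CharP F p]
    [FiniteDimensional F V] {H : Subgroup (V ≃ₗ[F] V)} (hH : IsPSolvable p H)
    (hV₂ : 2 ≤ finrank F V)
    (hV : (3 ≤ finrank F V ∧ ∃ a : Fˣ, a ≠ 1) ∨ ∃ a : Fˣ, a * a ≠ 1) :
    ∃ s ∈ transvections F V, s ∉ H := by
  by_contra! hcon
  have hp : p.Prime := CharP.char_is_prime F p
  set S : Set H := {s | (s : V ≃ₗ[F] V) ∈ transvections F V} with hS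
  have hcl : Subgroup.closure (transvections F V) = (Subgroup.closure S).map H.subtype := by
    rw [MonoidHom.map_closure]
    congr 1
    ext s
    constructor
    · exact fun hs => ⟨⟨s, hcon s hs⟩, hs, rfl⟩
    · rintro ⟨s, hs, rfl⟩
      exact hs
  have hcop : p.Coprime (Nat.card F - 1) := by
    rw [hp.coprime_iff_not_dvd]
    intro hdvd
    have h₁ : p ∣ Nat.card F := by
      rw [← CharP.cast_eq_zero_iff F p]
      have := Fintype.ofFinite F
      rw [Nat.card_eq_fintype_card]
      exact FiniteField.cast_card_eq_zero F
    have h₂ : Nat.card F - 1 + 1 = Nat.card F := Nat.sub_add_cancel Nat.card_pos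
    exact hp.one_lt.ne' (Nat.dvd_one.1 ((Nat.dvd_add_right hdvd).1 (h₂ ▸ h₁)))
  have htriv := hH.eq_one_of_eq_commutator S ?_ ?_
  · have : Nontrivial V := Module.nontrivial_of_finrank_pos (R := F) (by lia)
    obtain ⟨x, hx⟩ := exists_ne (0 : V)
    obtain ⟨y, hy⟩ : ∃ y, y ∉ Submodule.span F {x} := by
      by_contra! hall
      have h₁ := finrank_span_singleton (K := F) hx
      rw [(Submodule.eq_top_iff').2 hall, finrank_top] at h₁
      lia
    obtain ⟨-, e, -, -, h₃, h₄⟩ := exists_dual_pair (linearIndependent_pair_of_notMem_span hx hy)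
    have hs := transvection_mem_transvections (hfv := h₃)
    have h1 := congrArg Subtype.val (htriv ⟨_, hcon _ hs⟩ hs)
    have := LinearEquiv.congr_fun h1 y
    rw [LinearEquiv.transvection.apply, h₄] at this
    simp [hx] at this
  · rintro ⟨s, hsH⟩ ⟨f, x, h, rfl⟩
    ext v
    have hpw : ∀ k : ℕ, (transvection h ^ k) v = v + (k : F) • f v • x := by
      intro k
      induction k with
      | zero => simp
      | succ k ih =>
        rw [pow_succ', LinearEquiv.mul_apply, ih, LinearEquiv.transvection.apply]
        simp only [map_add, map_smul, h, smul_eq_mul]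
        push_cast
        module
    simp [hpw]
  · rintro s hs
    obtain ⟨d, hd, hd1, s', hs', hss⟩ := transvection_eq_commutator hV hs
    rw [hcl] at hd
    obtain ⟨d, hd, rfl⟩ := hd
    exact ⟨d, hd, _, hcop, Subtype.ext hd1, ⟨s', hcon s' hs'⟩, hs', Subtype.ext hss⟩

/-! ### Groups that meet every split torus nontrivially -/

/-- A finite set `C` of vectors spans `V` and only the scalars in `H` have all its members as
eigenvectors. -/
def IsScalarTest (H : Subgroup (V ≃ₗ[F] V)) (C : Finset V) : Prop :=
  Submodule.span F (C : Set V) = ⊤ ∧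
    ∀ h ∈ H, (∀ v ∈ C, ∃ c : F, h v = c • v) → ∃ c : Fˣ, ∀ w, h w = c • w

theorem exists_units_smul_of_ne_zero {h : V ≃ₗ[F] V} {v : V} (hv : v ≠ 0) {c : F}
    (hc : h v = c • v) : ∃ u : Fˣ, h v = u • v := by
  have : c ≠ 0 := by
    rintro rfl
    exact hv (by simpa using hc)
  exact ⟨Units.mk0 c this, hc⟩

/-- If `H` contains the scalars and the members of a basis do not form a scalar test for `H`, then
some element of `H` is diagonal in this basis, fixes a given basis vector and is not the
identity. -/
theorem exists_diagonal_of_not_isScalarTest [DecidableEq V] {H : Subgroup (V ≃ₗ[F] V)}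
    (hscal : ∀ c : Fˣ, ∃ z ∈ H, ∀ w, z w = c • w) {n : ℕ} (b : Basis (Fin n) F V) (i₀ : Fin n)
    (hb : ¬ IsScalarTest H (Finset.univ.image b)) :
    ∃ h ∈ H, ∃ u : Fin n → Fˣ, (∀ i, h (b i) = u i • b i) ∧ u i₀ = 1 ∧ ∃ i, u i ≠ 1 := by
  have hspan : Submodule.span F ((Finset.univ.image b : Finset V) : Set V) = ⊤ := by
    simp [b.span_eq]
  rw [IsScalarTest, not_and] at hb
  have hb := hb hspan
  push Not at hb
  obtain ⟨h, hh, heig, hns⟩ := hb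
  have hu : ∀ i, ∃ u : Fˣ, h (b i) = u • b i := fun i => by
    obtain ⟨c, hc⟩ := heig (b i) (by simp)
    exact exists_units_smul_of_ne_zero (b.ne_zero i) hc
  choose u hu using hu
  obtain ⟨z, hz, hzw⟩ := hscal (u i₀)⁻¹
  refine ⟨z * h, mul_mem hz hh, fun i => (u i₀)⁻¹ * u i, fun i => ?_, by simp, ?_⟩
  · rw [LinearEquiv.mul_apply, hzw, hu, mul_smul]
  · by_contra! hall
    obtain ⟨w, hw⟩ := hns (u i₀)
    refine hw (LinearMap.congr_fun (f := (h : V →ₗ[F] V)) (g := (u i₀ : F) • LinearMap.id)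
      (b.ext fun i => ?_) w)
    have := hall i
    rw [inv_mul_eq_one] at this
    simp only [LinearEquiv.coe_coe, hu, ← this]
    rfl

theorem exists_basis_two (hV : finrank F V = 2) {x w : V} (h : LinearIndependent F ![x, w]) :
    ∃ b : Basis (Fin 2) F V, b 0 = x ∧ b 1 = w :=
  ⟨basisOfLinearIndependentOfCardEqFinrank h (by simp [hV]), by simp, by simp⟩

theorem exists_basis_three (hV : finrank F V = 3) {x w₁ w₂ : V}
    (h : LinearIndependent F ![x, w₁, w₂]) :
    ∃ b : Basis (Fin 3) F V, b 0 = x ∧ b 1 = w₁ ∧ b 2 = w₂ :=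
  ⟨basisOfLinearIndependentOfCardEqFinrank h (by simp [hV]), by simp, by simp, by simp⟩

theorem linearIndependent_triple_iff {x w₁ w₂ : V} : LinearIndependent F ![x, w₁, w₂] ↔
    ∀ a b c : F, a • x + b • w₁ + c • w₂ = 0 → a = 0 ∧ b = 0 ∧ c = 0 := by
  rw [Fintype.linearIndependent_iff]
  constructor
  · intro h a b c habc
    have := h ![a, b, c] (by simpa [Fin.sum_univ_three] using habc)
    exact ⟨by simpa using this 0, by simpa using this 1, by simpa using this 2⟩
  · intro h g hg
    obtain ⟨h0, h1, h2⟩ := h (g 0) (g 1) (g 2) (by simpa [Fin.sum_univ_three] using hg)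
    intro i
    fin_cases i <;> assumption

theorem mul_apply_of_triangular {h h' : V ≃ₗ[F] V} {x w : V} {l l' : Fˣ} {r r' : F}
    (hx : h x = x) (hw : h w = l • w + r • x) (hw' : h' w = l' • w + r' • x) :
    (h * h') w = (l * l') • w + (l' * r + r') • x := by
  simp only [LinearEquiv.mul_apply, hw', map_add, Units.smul_def, map_smul, hx] at hw ⊢
  rw [hw]
  push_cast
  module

theorem inv_apply_of_triangular {h : V ≃ₗ[F] V} {x w : V} {l : Fˣ} {r : F}
    (hx : h x = x) (hw : h w = l • w + r • x) :
    h⁻¹ w = l⁻¹ • w + (-(r * (l⁻¹ : Fˣ))) • x := by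
  have : h (l⁻¹ • w + (-(r * (l⁻¹ : Fˣ))) • x) = w := by
    simp only [map_add, Units.smul_def, map_smul, hx] at hw ⊢
    rw [hw]
    have hl : (l : F) ≠ 0 := l.ne_zero
    rw [Units.val_inv_eq_inv_val]
    match_scalars <;> field_simp
    ring
  rw [← this]
  exact LinearEquiv.symm_apply_apply h _ |>.trans (by rw [this])

theorem inv_apply_of_apply {h : V ≃ₗ[F] V} {x : V} (hx : h x = x) : h⁻¹ x = x :=
  (LinearEquiv.symm_apply_eq h).2 hx.symm

/-- In dimension two, if the group meets every split torus in a nonscalar element, then it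
contains all transvections. -/
theorem transvections_subset_of_finrank_eq_two [Finite F] [DecidableEq V]
    {H : Subgroup (V ≃ₗ[F] V)} (hscal : ∀ c : Fˣ, ∃ z ∈ H, ∀ w, z w = c • w)
    (hV : finrank F V = 2)
    (hbad : ∀ b : Basis (Fin 2) F V, ¬ IsScalarTest H (Finset.univ.image b)) :
    transvections F V ⊆ H := by
  rintro _ ⟨f, x, hfx, rfl⟩
  by_cases hx : x = 0
  · subst hx
    rw [LinearEquiv.transvection.of_right_eq_zero]
    exact one_mem H
  by_cases hf : f = 0
  · subst hf
    rw [LinearEquiv.transvection.of_left_eq_zero]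
    exact one_mem H
  obtain ⟨w, hw⟩ : ∃ w, f w = 1 := LinearMap.surjective hf 1
  have hind : ∀ α : F, LinearIndependent F ![x, w + α • x] := by
    intro α
    refine linearIndependent_pair_of_notMem_span hx fun hmem => ?_
    obtain ⟨r, hr⟩ := Submodule.mem_span_singleton.1 hmem
    have := congrArg f hr
    simp [hfx, hw] at this
  let P : Fˣ → F → Prop := fun l r => ∃ h ∈ H, h x = x ∧ h w = l • w + r • x
  have hfix : ∀ α : F, ∃ l : Fˣ, l ≠ 1 ∧ P l ((l - 1) * α) := by
    intro α
    obtain ⟨b, hb0, hb1⟩ := exists_basis_two hV (hind α)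
    obtain ⟨h, hh, u, hu, hu0, i, hi⟩ := exists_diagonal_of_not_isScalarTest hscal b 0 (hbad b)
    have h0 := hu 0
    have h1 := hu 1
    rw [hb0, hu0, one_smul] at h0
    rw [hb1, map_add, map_smul, h0] at h1
    refine ⟨u 1, ?_, h, hh, h0, ?_⟩
    · fin_cases i
      · exact absurd hu0 hi
      · exact hi
    · simp only [eq_sub_of_add_eq h1, Units.smul_def]
      module
  -- The two coordinates of the affine plane are treated alike.
  have hN := translations_of_fixes (fun l m r s => P l r ∧ P m s) ?_ ?_ ?_
  · have hall : ∀ a, P 1 a := by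
      rcases hN with hN | hN
      · exact fun a => (hN a).1
      · exact fun a => (hN a).2
    obtain ⟨h, hh, h0, h1⟩ := hall 1
    obtain ⟨b, hb0, hb1⟩ := exists_basis_two hV (hind 0)
    suffices heq : transvection hfx = h from heq ▸ hh
    refine LinearEquiv.toLinearMap_injective (b.ext fun i => ?_)
    fin_cases i
    · simp [hb0, hfx, h0, LinearMap.transvection.apply]
    · simp [hb1, hw, h1, LinearMap.transvection.apply]
  · have hmul : ∀ {l r l' r'}, P l r → P l' r' → P (l * l') (l' * r + r') := by
      rintro l r l' r' ⟨h, hh, h0, h1⟩ ⟨h', hh', h0', h1'⟩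
      exact ⟨h * h', mul_mem hh hh', by rw [LinearEquiv.mul_apply, h0', h0],
        mul_apply_of_triangular h0 h1 h1'⟩
    intro _ _ _ _ _ _ _ _ h h'
    exact ⟨hmul h.1 h'.1, hmul h.2 h'.2⟩
  · have hinv : ∀ {l r}, P l r → P l⁻¹ (-(r * (l⁻¹ : Fˣ))) := by
      rintro l r ⟨h, hh, h0, h1⟩
      exact ⟨h⁻¹, inv_mem hh, inv_apply_of_apply h0, inv_apply_of_triangular h0 h1⟩
    intro _ _ _ _ h
    exact ⟨hinv h.1, hinv h.2⟩
  · intro α β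
    obtain ⟨l, hl, h⟩ := hfix α
    obtain ⟨m, hm, h'⟩ := hfix β
    exact ⟨l, m, Or.inl hl, h, h'⟩

/-- Let `(x, w₁, w₂)` be a basis of `V` such that `H` meets in a nonscalar element the split torus
of every basis `(x, w₁ + α x, w₂ + β x)`. Then `H` contains all transvections with centre `x`
that fix `w₂`, or all those that fix `w₁`. -/
theorem transvections_of_triple [Finite F] [DecidableEq V]
    {H : Subgroup (V ≃ₗ[F] V)} (hscal : ∀ c : Fˣ, ∃ z ∈ H, ∀ w, z w = c • w)
    (hV : finrank F V = 3)
    (hbad : ∀ b : Basis (Fin 3) F V, ¬ IsScalarTest H (Finset.univ.image b))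
    {x w₁ w₂ : V} (hind : LinearIndependent F ![x, w₁, w₂]) :
    (∀ a : F, ∃ h ∈ H, h x = x ∧ h w₁ = w₁ + a • x ∧ h w₂ = w₂) ∨
      ∀ a : F, ∃ h ∈ H, h x = x ∧ h w₁ = w₁ ∧ h w₂ = w₂ + a • x := by
  rw [linearIndependent_triple_iff] at hind
  let P : Fˣ → Fˣ → F → F → Prop := fun l m r s =>
    ∃ h ∈ H, h x = x ∧ h w₁ = l • w₁ + r • x ∧ h w₂ = m • w₂ + s • x
  have hN := translations_of_fixes P ?_ ?_ ?_
  · simpa [P] using hN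
  · rintro l m r s l' m' r' s' ⟨h, hh, h0, h1, h2⟩ ⟨h', hh', h0', h1', h2'⟩
    exact ⟨h * h', mul_mem hh hh', by rw [LinearEquiv.mul_apply, h0', h0],
      mul_apply_of_triangular h0 h1 h1', mul_apply_of_triangular h0 h2 h2'⟩
  · rintro l m r s ⟨h, hh, h0, h1, h2⟩
    exact ⟨h⁻¹, inv_mem hh, inv_apply_of_apply h0, inv_apply_of_triangular h0 h1,
      inv_apply_of_triangular h0 h2⟩
  · intro α β
    have hind' : LinearIndependent F ![x, w₁ + α • x, w₂ + β • x] := by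
      rw [linearIndependent_triple_iff]
      intro a b c habc
      obtain ⟨h0, rfl, rfl⟩ := hind (a + b * α + c * β) b c (by rw [← habc]; module)
      simpa using h0
    obtain ⟨b, hb0, hb1, hb2⟩ := exists_basis_three hV hind'
    obtain ⟨h, hh, u, hu, hu0, i, hi⟩ := exists_diagonal_of_not_isScalarTest hscal b 0 (hbad b)
    have h0 := hu 0
    have h1 := hu 1
    have h2 := hu 2
    rw [hb0, hu0, one_smul] at h0
    rw [hb1, map_add, map_smul, h0] at h1
    rw [hb2, map_add, map_smul, h0] at h2
    refine ⟨u 1, u 2, ?_, h, hh, h0, ?_, ?_⟩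
    · fin_cases i
      · exact absurd hu0 hi
      · exact Or.inl hi
      · exact Or.inr hi
    · simp only [eq_sub_of_add_eq h1, Units.smul_def]
      module
    · simp only [eq_sub_of_add_eq h2, Units.smul_def]
      module

/-- In dimension three, if the group meets every split torus in a nonscalar element, then it
contains all transvections. -/
theorem transvections_subset_of_finrank_eq_three [Finite F] [DecidableEq V]
    {H : Subgroup (V ≃ₗ[F] V)} (hscal : ∀ c : Fˣ, ∃ z ∈ H, ∀ w, z w = c • w)
    (hV : finrank F V = 3)
    (hbad : ∀ b : Basis (Fin 3) F V, ¬ IsScalarTest H (Finset.univ.image b)) :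
    transvections F V ⊆ H := by
  have : FiniteDimensional F V := Module.finite_of_finrank_pos (by lia)
  rintro _ ⟨f, x, hfx, rfl⟩
  by_cases hx : x = 0
  · subst hx
    rw [LinearEquiv.transvection.of_right_eq_zero]
    exact one_mem H
  by_cases hf : f = 0
  · subst hf
    rw [LinearEquiv.transvection.of_left_eq_zero]
    exact one_mem H
  obtain ⟨w₂, hw₂⟩ : ∃ w, f w = 1 := LinearMap.surjective hf 1
  obtain ⟨w₁, hw₁, hxw⟩ := exists_linearIndependent_pair_mem_ker hV.ge f hx
  rw [LinearIndependent.pair_iff] at hxw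
  have hind : LinearIndependent F ![x, w₁, w₂] := by
    rw [linearIndependent_triple_iff]
    intro a b c habc
    have hc : c = 0 := by simpa [hfx, hw₁, hw₂] using congrArg f habc
    subst hc
    obtain ⟨ha, hb⟩ := hxw a b (by simpa using habc)
    exact ⟨ha, hb, rfl⟩
  suffices hsuff : ∃ h ∈ H, h x = x ∧ h w₁ = w₁ ∧ h w₂ = w₂ + (1 : F) • x by
    obtain ⟨h, hh, h0, h1, h2⟩ := hsuff
    obtain ⟨b, hb0, hb1, hb2⟩ := exists_basis_three hV hind
    suffices heq : transvection hfx = h from heq ▸ hh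
    refine LinearEquiv.toLinearMap_injective (b.ext fun i => ?_)
    fin_cases i
    · simp [hb0, hfx, h0, LinearMap.transvection.apply]
    · simp [hb1, hw₁, h1, LinearMap.transvection.apply]
    · simp [hb2, hw₂, h2, LinearMap.transvection.apply]
  rcases transvections_of_triple hscal hV hbad hind with hA | hA
  · have hind' : LinearIndependent F ![x, w₁, w₁ + w₂] := by
      rw [linearIndependent_triple_iff] at hind ⊢
      intro a b c habc
      obtain ⟨ha, hb, hc⟩ := hind a (b + c) c (by rw [← habc]; module)
      exact ⟨ha, by simpa [hc] using hb, hc⟩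
    rcases transvections_of_triple hscal hV hbad hind' with hB | hB
    · obtain ⟨h, hh, h0, h1, h2⟩ := hA 1
      obtain ⟨h', hh', h0', h1', h2'⟩ := hB (-1)
      rw [map_add, h1'] at h2'
      refine ⟨h * h', mul_mem hh hh', ?_, ?_, ?_⟩
      · rw [LinearEquiv.mul_apply, h0', h0]
      · rw [LinearEquiv.mul_apply, h1', map_add, map_smul, h1, h0]
        module
      · have : h' w₂ = w₂ + (1 : F) • x := by
          rw [eq_sub_of_add_eq' h2']
          module
        rw [LinearEquiv.mul_apply, this, map_add, map_smul, h2, h0]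
    · obtain ⟨h', hh', h0', h1', h2'⟩ := hB 1
      refine ⟨h', hh', h0', h1', ?_⟩
      rw [map_add, h1', add_assoc] at h2'
      exact add_left_cancel h2'
  · exact hA 1

/-! ### Scalar tests and strong bases -/

theorem card_image_basis_le [DecidableEq V] {n : ℕ} (b : Basis (Fin n) F V) :
    (Finset.univ.image b).card ≤ n := by
  simpa using Finset.card_image_le (s := Finset.univ) (f := b)

theorem isScalarTest_insert_add [DecidableEq V] (H : Subgroup (V ≃ₗ[F] V))
    (b : Basis (Fin 2) F V) : IsScalarTest H {b 0, b 1, b 0 + b 1} := by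
  constructor
  · rw [eq_top_iff, ← b.span_eq]
    refine Submodule.span_mono ?_
    rintro _ ⟨i, rfl⟩
    fin_cases i <;> simp
  · intro h _ heig
    obtain ⟨c₀, h₀⟩ := heig (b 0) (by simp)
    obtain ⟨c₁, h₁⟩ := heig (b 1) (by simp)
    obtain ⟨c, hc⟩ := heig (b 0 + b 1) (by simp)
    rw [map_add, h₀, h₁] at hc
    have hli := Fintype.linearIndependent_iff.1 b.linearIndependent ![c₀ - c, c₁ - c] (by
      rw [Fin.sum_univ_two]
      simp only [Matrix.cons_val_zero, Matrix.cons_val_one]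
      rw [sub_smul, sub_smul, sub_add_sub_comm, hc, smul_add, sub_self])
    have e₀ : c₀ - c = 0 := hli 0
    have e₁ : c₁ - c = 0 := hli 1
    have hc₀ : c₀ = c := sub_eq_zero.1 e₀
    have hc₁ : c₁ = c := sub_eq_zero.1 e₁
    subst hc₀
    obtain ⟨u, hu⟩ := exists_units_smul_of_ne_zero (b.ne_zero 0) h₀
    refine ⟨u, fun w => LinearMap.congr_fun (f := (h : V →ₗ[F] V))
      (g := (u : F) • LinearMap.id) (b.ext fun i => ?_) w⟩
    have huc : (u : F) = c₀ := by
      rw [h₀, Units.smul_def] at hu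
      exact (smul_left_injective F (b.ne_zero 0) hu).symm
    fin_cases i
    · simp [h₀, huc]
    · simp [h₁, hc₁, huc]

theorem exists_units_mul_self_ne_one [Finite F] (hF : 4 < Nat.card F) :
    ∃ a : Fˣ, a * a ≠ 1 := by
  classical
  have := Fintype.ofFinite F
  by_contra! hall
  have hsub : (Finset.univ : Finset F) ⊆ {0, 1, -1} := by
    intro a _
    by_cases ha : a = 0
    · simp [ha]
    · have h1 := congrArg Units.val (hall (Units.mk0 a ha))
      rcases mul_self_eq_one_iff.1 (by simpa using h1) with h | h <;> simp [h]
  have h₁ := Finset.card_le_card hsub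
  have h₂ := Finset.card_le_three (a := (0 : F)) (b := 1) (c := -1)
  rw [Finset.card_univ, ← Nat.card_eq_fintype_card] at h₁
  lia

/-- A `p`-solvable linear group containing the scalars, of dimension at most `t q`, has a scalar
test of size at most `t q`. -/
theorem exists_isScalarTest {p : ℕ} [Finite F] [CharP F p] [FiniteDimensional F V]
    [DecidableEq V] {H : Subgroup (V ≃ₗ[F] V)} (hH : IsPSolvable p H)
    (hscal : ∀ c : Fˣ, ∃ z ∈ H, ∀ w, z w = c • w) (hV : finrank F V ≤ t (Nat.card F)) :
    ∃ C : Finset V, C.card ≤ t (Nat.card F) ∧ IsScalarTest H C := by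
  by_contra! hno
  have hbad : ∀ {n : ℕ} (_ : finrank F V = n) (b : Basis (Fin n) F V),
      ¬ IsScalarTest H (Finset.univ.image b) := fun hn b =>
    hno _ ((card_image_basis_le b).trans (hn ▸ hV))
  have hpos : finrank F V ≠ 0 := by
    intro h0
    have hsub := finrank_zero_iff.1 h0
    refine hbad rfl (finBasis F V) ⟨(Basis.span_eq (finBasis F V)) ▸ by simp, fun h _ _ => ?_⟩
    exact ⟨1, fun w => Subsingleton.elim _ _⟩
  -- A nonscalar diagonal element with one eigenvalue `1` needs two basis vectors and a nontrivial
  -- scalar.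
  obtain ⟨a, ha, hge⟩ : ∃ a : Fˣ, a ≠ 1 ∧ 2 ≤ finrank F V := by
    obtain ⟨h, -, u, -, hu, i, hi⟩ := exists_diagonal_of_not_isScalarTest hscal (finBasis F V)
      ⟨0, by lia⟩ (hbad rfl _)
    refine ⟨u i, hi, ?_⟩
    have hne : i ≠ ⟨0, by lia⟩ := fun h => hi (h ▸ hu)
    have := i.isLt
    have : (i : ℕ) ≠ 0 := fun h => hne (Fin.ext h)
    lia
  have hsmall : ∃ s ∈ transvections F V, s ∉ H := by
    refine hH.exists_transvection_notMem hge ?_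
    by_cases hq : Nat.card F ≤ 4
    · refine Or.inl ⟨?_, a, ha⟩
      by_contra hlt
      have h2 : finrank F V = 2 := by lia
      refine hno _ ?_ (isScalarTest_insert_add H (finBasisOfFinrankEq F V h2))
      rw [t, if_pos hq]
      exact Finset.card_le_three
    · exact Or.inr (exists_units_mul_self_ne_one (by lia))
  obtain ⟨s, hs, hsH⟩ := hsmall
  have ht : t (Nat.card F) ≤ 3 := by
    unfold t
    split_ifs <;> lia
  obtain h2 | h3 : finrank F V = 2 ∨ finrank F V = 3 := by lia
  · exact hsH (transvections_subset_of_finrank_eq_two hscal h2 (hbad h2) hs)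
  · exact hsH (transvections_subset_of_finrank_eq_three hscal h3 (hbad h3) hs)

/-- The group of automorphisms of the subspace `U` that are restrictions of elements of `G`. -/
def restrictionGroup (G : Subgroup (LinearMap.GeneralLinearGroup F V)) (U : Submodule F V) :
    Subgroup (U ≃ₗ[F] U) where
  carrier := {h | ∃ g ∈ G, ∀ w : U, (g : Module.End F V) w = h w}
  one_mem' := ⟨1, one_mem G, fun _ => rfl⟩
  mul_mem' := by
    rintro h h' ⟨g, hg, hgh⟩ ⟨g', hg', hgh'⟩
    exact ⟨g * g', mul_mem hg hg', fun w => by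
      rw [Units.val_mul, Module.End.mul_apply, hgh', hgh, LinearEquiv.mul_apply]⟩
  inv_mem' := by
    rintro h ⟨g, hg, hgh⟩
    refine ⟨g⁻¹, inv_mem hg, fun w => ?_⟩
    have hw : (g : Module.End F V) (h⁻¹ w : U) = w := by
      rw [hgh]
      exact congrArg Subtype.val (LinearEquiv.apply_symm_apply h w)
    conv_lhs => rw [← hw]
    rw [← Module.End.mul_apply, ← Units.val_mul, inv_mul_cancel]
    rfl

theorem mem_restrictionGroup {G : Subgroup (LinearMap.GeneralLinearGroup F V)}
    {U : Submodule F V} {h : U ≃ₗ[F] U} :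
    h ∈ restrictionGroup G U ↔ ∃ g ∈ G, ∀ w : U, (g : Module.End F V) w = h w :=
  Iff.rfl

theorem IsBase.eq_one_of_span {G : Subgroup (LinearMap.GeneralLinearGroup F V)} {B : Finset V}
    (hB : IsBase G B) {g : LinearMap.GeneralLinearGroup F V} (hg : g ∈ G)
    (h : ∀ w : Submodule.span F (B : Set V), (g : Module.End F V) w = w) : g = 1 :=
  hB g hg fun v hv => h ⟨v, Submodule.subset_span hv⟩

/-- If `B` is a base for `G`, then the stabilizer in `G` of the span of `B` acts faithfully on
this span. -/
theorem IsBase.isPSolvable_restrictionGroup {p : ℕ} (hp : p.Prime)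
    {G : Subgroup (LinearMap.GeneralLinearGroup F V)} {B : Finset V}
    (hB : IsBase G B) (hG : IsPSolvable p G) :
    IsPSolvable p (restrictionGroup G (Submodule.span F (B : Set V))) := by
  set U := Submodule.span F (B : Set V) with hU
  have huniq : ∀ g ∈ G, ∀ g' ∈ G,
      (∀ w : U, (g : Module.End F V) w = (g' : Module.End F V) w) → g = g' := by
    intro g hg g' hg' h
    rw [← inv_mul_eq_one]
    refine hB.eq_one_of_span (mul_mem (inv_mem hg) hg') fun w => ?_
    rw [Units.val_mul, Module.End.mul_apply, ← h w, ← Module.End.mul_apply, ← Units.val_mul,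
      inv_mul_cancel]
    rfl
  choose φ hφG hφ using fun h : restrictionGroup G U => mem_restrictionGroup.1 h.2
  let Φ : restrictionGroup G U →* G := MonoidHom.mk' (fun h => ⟨φ h, hφG h⟩) fun h h' => by
    refine Subtype.ext (huniq _ (hφG _) _ (mul_mem (hφG h) (hφG h')) fun w => ?_)
    change _ = ((φ h * φ h' : LinearMap.GeneralLinearGroup F V) : Module.End F V) w
    rw [hφ, Units.val_mul, Module.End.mul_apply, hφ h', hφ h]
    rfl
  refine IsPSolvable.of_injective hp Φ ?_ hG
  intro h h' heq
  have heq' : φ h = φ h' := congrArg Subtype.val heq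
  refine Subtype.ext (LinearEquiv.ext fun w => Subtype.ext ?_)
  rw [← hφ h w, ← hφ h' w, heq']

theorem exists_smul_unit (c : Fˣ) : ∃ z ∈ scalars F V, ∀ v, (z : Module.End F V) v = c • v :=
  ⟨_, ⟨c, rfl⟩, fun _ => rfl⟩

/-- A scalar test for the restriction of `G` to the span of a base is a strong base for `G`. -/
theorem IsBase.isStrongBase_of_isScalarTest [FiniteDimensional F V] [DecidableEq V]
    {G : Subgroup (LinearMap.GeneralLinearGroup F V)} (hZ : scalars F V ≤ G) {B : Finset V}
    (hB : IsBase G B) {C : Finset (Submodule.span F (B : Set V))}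
    (hC : IsScalarTest (restrictionGroup G (Submodule.span F (B : Set V))) C) :
    IsStrongBase G (C.image Subtype.val) := by
  intro g hg hgC
  have heig : ∀ w ∈ C, ∃ c : F, (g : Module.End F V) (w : V) = c • (w : V) := by
    intro w hw
    have h₁ := hgC w (Finset.mem_image_of_mem _ hw)
    have h₂ : (g : Module.End F V) (w : V) ∈
        (Submodule.span F {(w : V)}).map (g : Module.End F V) :=
      Submodule.mem_map_of_mem (Submodule.mem_span_singleton_self _)
    rw [h₁, Submodule.mem_span_singleton] at h₂
    obtain ⟨c, hc⟩ := h₂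
    exact ⟨c, hc.symm⟩
  have hmaps : ∀ w : Submodule.span F (B : Set V), (g : Module.End F V) (w : V) ∈
      Submodule.span F (B : Set V) := by
    intro w
    have hw : w ∈ Submodule.span F (C : Set (Submodule.span F (B : Set V))) :=
      hC.1 ▸ Submodule.mem_top
    induction hw using Submodule.span_induction with
    | mem w hw =>
      obtain ⟨c, hc⟩ := heig w hw
      rw [hc]
      exact Submodule.smul_mem _ c w.2
    | zero => simp
    | add w w' _ _ h h' =>
      rw [Submodule.coe_add, map_add]
      exact Submodule.add_mem _ h h'
    | smul c w _ h =>
      rw [Submodule.coe_smul, map_smul]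
      exact Submodule.smul_mem _ c h
  have hinj : Function.Injective (g : Module.End F V) :=
    ((Module.End.isUnit_iff _).1 g.isUnit).injective
  have hinjU : Function.Injective ((g : Module.End F V).restrict fun w hw => hmaps ⟨w, hw⟩) :=
    fun w w' h => Subtype.ext (hinj (congrArg Subtype.val h))
  obtain ⟨c, hc⟩ := hC.2 (LinearEquiv.ofInjectiveEndo _ hinjU) ⟨g, hg, fun w => rfl⟩
    fun w hw => by
      obtain ⟨c, hc⟩ := heig w hw
      exact ⟨c, Subtype.ext hc⟩
  obtain ⟨z, hz, hzv⟩ := exists_smul_unit (V := V) c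
  have hgz : z⁻¹ * g = 1 := by
    refine hB.eq_one_of_span (mul_mem (inv_mem (hZ hz)) hg) fun w => ?_
    have hw : (g : Module.End F V) (w : V) = (z : Module.End F V) w := by
      rw [hzv]
      exact congrArg Subtype.val (hc w)
    rw [Units.val_mul, Module.End.mul_apply, hw, ← Module.End.mul_apply, ← Units.val_mul,
      inv_mul_cancel]
    rfl
  rw [inv_mul_eq_one] at hgz
  exact hgz ▸ hz

theorem exists_isBase_card_eq_baseSize [Finite V]
    (G : Subgroup (LinearMap.GeneralLinearGroup F V)) :
    ∃ B : Finset V, B.card = baseSize G ∧ IsBase G B := by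
  have := Fintype.ofFinite V
  refine Nat.sInf_mem (s := {k | ∃ B : Finset V, B.card = k ∧ IsBase G B})
    ⟨_, Finset.univ, rfl, fun g _ h => ?_⟩
  exact Units.ext (LinearMap.ext fun v => h v (Finset.mem_univ v))

end LinearBase

theorem corollary3p3 {F V : Type*} [Field F] [Finite F] [AddCommGroup V] [Module F V]
    [FiniteDimensional F V] (p q : ℕ) [CharP F p] (hq : Nat.card F = q)
    (G : Subgroup (LinearMap.GeneralLinearGroup F V))
    (hZ : LinearBase.scalars F V ≤ G)
    (hG : LinearBase.IsPSolvable p G)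
    (hb : LinearBase.baseSize G ≤ LinearBase.t q) :
    LinearBase.strongBaseSize G ≤ LinearBase.t q := by
  classical
  subst hq
  have : Finite V := Module.finite_of_finite F
  have hp : p.Prime := CharP.char_is_prime F p
  obtain ⟨B, hBcard, hB⟩ := LinearBase.exists_isBase_card_eq_baseSize G
  have hdim : Module.finrank F (Submodule.span F (B : Set V)) ≤ LinearBase.t (Nat.card F) :=
    (finrank_span_finset_le_card B).trans (hBcard ▸ hb)
  obtain ⟨C, hCcard, hC⟩ := LinearBase.exists_isScalarTest
    (hB.isPSolvable_restrictionGroup hp hG) (fun c => by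
      obtain ⟨z, hz, hzv⟩ := LinearBase.exists_smul_unit (V := V) c
      exact ⟨LinearEquiv.smulOfUnit c, ⟨z, hZ hz, fun w => hzv w⟩, fun w => rfl⟩) hdim
  have hle : LinearBase.strongBaseSize G ≤ (C.image Subtype.val).card :=
    Nat.sInf_le ⟨_, rfl, hB.isStrongBase_of_isScalarTest hZ hC⟩
  exact hle.trans (Finset.card_image_le.trans hCcard)
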